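/- Let $\mathbb K$ be $\mathbb R$ or $\mathbb C$. For a family $(E_i)_{i\in I}$ of locally convex spaces over $\mathbb K$, let $\bigoplus\{E_i : i\in I\}$ denote its locally convex direct sum, i.e. the vector space of all families $(x_i)_{i \in I}$ with $x_i\in E_i$ and only finitely many $x_i \neq 0$, equipped with the finest locally convex topology for which all canonical inclusions $E_i\to\bigoplus\{E_i : i\in I\}$ are continuous. A linear subspace $X$ of a locally convex space $E$ is called complemented if, in the subspace topology, there is a continuous linear map $r\colon E\to X$ with $r(x)=x$ for all $x\in X$. Let $T$ be an uncountable set, let $(B_t)_{t\in T}$ be a family of Banach spaces over $\mathbb K$, and let $X$ be a complemented subspace of $\bigoplus\{B_t : t\in T\}$. Then there exist a set $J$, subsets $T_j\subseteq T$ with $|T_j|=\omega$ (that is, countably infinite) for each $j\in J$, and complemented subspaces $F_j$ of $\bigoplus\{B_t : t\in T_j\}$ for each $j \in J$, such that $X$ is isomorphic (linearly homeomorphic) to the locally convex direct sum $\bigoplus\{F_j : j\in J\}$. -/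

import Mathlib

universe u v w

/-- The algebraic direct sum of the family `E`, the underlying vector space of the locally convex
direct sum. The scalar field is recorded because the topology below depends on it. -/
def LCDirectSum (_𝕜 : Type*) {ι : Type*} (E : ι → Type*) [∀ i, AddCommGroup (E i)] : Type _ :=
  Π₀ i, E i

namespace LCDirectSum

section

variable (𝕜 : Type*) {ι : Type*} (E : ι → Type*)

noncomputable instance instAddCommGroup [∀ i, AddCommGroup (E i)] :
    AddCommGroup (LCDirectSum 𝕜 E) :=
  inferInstanceAs (AddCommGroup (Π₀ i, E i))

noncomputable instance instModule [RCLike 𝕜] [∀ i, AddCommGroup (E i)] [∀ i, Module 𝕜 (E i)] :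
    Module 𝕜 (LCDirectSum 𝕜 E) :=
  inferInstanceAs (Module 𝕜 (Π₀ i, E i))

open Classical in
/-- The canonical inclusion of the summand `E i`. -/
noncomputable def incl [RCLike 𝕜] [∀ i, AddCommGroup (E i)] [∀ i, Module 𝕜 (E i)] (i : ι) :
    E i →ₗ[𝕜] LCDirectSum 𝕜 E :=
  DFinsupp.lsingle (R := 𝕜) (M := E) i

variable [RCLike 𝕜] [∀ i, AddCommGroup (E i)] [∀ i, Module 𝕜 (E i)] [∀ i, TopologicalSpace (E i)]

/-- The seminorms on the algebraic direct sum whose restriction to every summand is continuous. -/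
def AdmissibleSeminorm : Type _ :=
  {p : Seminorm 𝕜 (LCDirectSum 𝕜 E) // ∀ i, Continuous fun x : E i => p (incl 𝕜 E i x)}

instance instNonemptyAdmissibleSeminorm : Nonempty (AdmissibleSeminorm 𝕜 E) :=
  ⟨⟨0, fun _ => continuous_const⟩⟩

/-- The family of all admissible seminorms. -/
def seminormFamily : SeminormFamily 𝕜 (LCDirectSum 𝕜 E) (AdmissibleSeminorm 𝕜 E) :=
  fun p => p.1

/-- The locally convex direct sum topology, that is, the finest locally convex topology for which
all the inclusions of the summands are continuous. As a locally convex topology is generated by its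
continuous seminorms, it is the topology generated by all seminorms whose restrictions to the
summands are continuous. -/
noncomputable instance instTopologicalSpace : TopologicalSpace (LCDirectSum 𝕜 E) :=
  (seminormFamily 𝕜 E).moduleFilterBasis.topology

theorem withSeminorms : WithSeminorms (seminormFamily 𝕜 E) := ⟨rfl⟩

/-- The inclusions of the summands are continuous. -/
theorem continuous_incl [∀ i, IsTopologicalAddGroup (E i)] (i : ι) :
    Continuous (incl 𝕜 E i) := by
  rw [continuous_iff_continuousAt]
  intro x
  refine ((withSeminorms 𝕜 E).tendsto_nhds _ _).2 fun p ε hε => ?_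
  have h : Continuous fun y : E i => p.1 (incl 𝕜 E i (y - x)) :=
    (p.2 i).comp (continuous_id.sub continuous_const)
  have h0 := h.tendsto x
  simp only [sub_self, map_zero] at h0
  filter_upwards [h0.eventually (gt_mem_nhds hε)] with y hy
  simpa [seminormFamily, map_sub] using hy

/-- Universal property: a linear map into a locally convex space is continuous as soon as its
restrictions to the summands are. -/
theorem continuous_of_incl {κ F : Type*} [AddCommGroup F] [Module 𝕜 F] [TopologicalSpace F]
    {q : SeminormFamily 𝕜 F κ} (hq : WithSeminorms q) (f : LCDirectSum 𝕜 E →ₗ[𝕜] F)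
    (hf : ∀ i, Continuous fun x => f (incl 𝕜 E i x)) : Continuous f := by
  have := (withSeminorms 𝕜 E).topologicalAddGroup
  refine WithSeminorms.continuous_of_continuous_comp hq f fun k => ?_
  exact (withSeminorms 𝕜 E).continuous_seminorm
    ⟨(q k).comp f, fun i => (hq.continuous_seminorm k).comp (hf i)⟩

/-- The topology is finer than every locally convex topology for which the inclusions of the
summands are continuous. -/
theorem topology_le {κ : Type*} (q : SeminormFamily 𝕜 (LCDirectSum 𝕜 E) κ)
    (t : TopologicalSpace (LCDirectSum 𝕜 E)) (ht : @WithSeminorms 𝕜 _ κ _ _ _ q t)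
    (hincl : ∀ i, @Continuous _ _ _ t (incl 𝕜 E i)) : instTopologicalSpace 𝕜 E ≤ t :=
  continuous_id_iff_le.1 (@continuous_of_incl 𝕜 _ E _ _ _ _ κ _ _ _ t q ht LinearMap.id hincl)

end

end LCDirectSum

/-! Let `P` be a continuous projection of the direct sum onto `X`. A continuous linear map from a
normed space into a direct sum of normed spaces only meets finitely many coordinates
(`finite_coord_ne_zero_of_continuous`), so `P` sends each summand into a finite partial sum. A
closing-off argument (`exists_countable_fibers`) then yields a map `ρ` from the index set to a
well-ordered set, with countably infinite fibers, such that `P` never raises `ρ`: it is block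
triangular.

The diagonal blocks of a triangular idempotent are idempotent, so their ranges are complemented and
serve as the `F j`. Applying `P` to each of these ranges gives a map `fromBlocks` from their direct
sum to `X`. It is injective because the top component survives, surjective by well-founded recursion
on `ρ`, and the same recursion shows that its inverse is continuous (`nonempty_equiv_blockSum`). -/

namespace LCDirectSum

/-! ### Coordinates, supports, restriction and extension by zero. -/

section Basic

variable {𝕜 : Type*} [RCLike 𝕜] {ι : Type*} {E : ι → Type*} [∀ i, AddCommGroup (E i)]
  [∀ i, Module 𝕜 (E i)]

/-- The coordinate maps of the direct sum. -/
noncomputable def coord (𝕜 : Type*) [RCLike 𝕜] {ι : Type*} (E : ι → Type*) [∀ i, AddCommGroup (E i)]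
    [∀ i, Module 𝕜 (E i)] (i : ι) : LCDirectSum 𝕜 E →ₗ[𝕜] E i :=
  DFinsupp.lapply (R := 𝕜) (M := E) i

@[simp]
theorem coord_incl_self (i : ι) (x : E i) : coord 𝕜 E i (incl 𝕜 E i x) = x := by
  classical
  exact DFinsupp.single_eq_same (β := E)

theorem coord_incl_of_ne {i j : ι} (h : j ≠ i) (x : E j) : coord 𝕜 E i (incl 𝕜 E j x) = 0 := by
  classical
  exact DFinsupp.single_eq_of_ne (β := E) (Ne.symm h)

theorem ext_coord {x y : LCDirectSum 𝕜 E} (h : ∀ i, coord 𝕜 E i x = coord 𝕜 E i y) : x = y :=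
  DFinsupp.ext h

theorem finite_coord_ne_zero (x : LCDirectSum 𝕜 E) : {i | coord 𝕜 E i x ≠ 0}.Finite :=
  DFinsupp.finite_support (β := E) x

theorem linearMap_ext {F : Type*} [AddCommGroup F] [Module 𝕜 F] {f g : LCDirectSum 𝕜 E →ₗ[𝕜] F}
    (h : ∀ i x, f (incl 𝕜 E i x) = g (incl 𝕜 E i x)) : f = g := by
  classical
  refine DFinsupp.lhom_ext' (M := E) fun i => LinearMap.ext fun x => ?_
  exact h i x

open Classical in
/-- The linear map on the direct sum with given restrictions to the summands. -/
noncomputable def lift {F : Type*} [AddCommGroup F] [Module 𝕜 F] (f : ∀ i, E i →ₗ[𝕜] F) :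
    LCDirectSum 𝕜 E →ₗ[𝕜] F :=
  DFinsupp.lsum ℕ (M := E) f

@[simp]
theorem lift_incl {F : Type*} [AddCommGroup F] [Module 𝕜 F] (f : ∀ i, E i →ₗ[𝕜] F) (i : ι)
    (x : E i) : lift f (incl 𝕜 E i x) = f i x := by
  classical
  simp only [lift, incl]
  exact DFinsupp.lsum_single (M := E) ℕ f i x

/-- The quotient map by `p` kills every summand, hence vanishes. This serves as an induction
principle on the summands. -/
theorem eq_top_of_incl_mem (p : Submodule 𝕜 (LCDirectSum 𝕜 E)) (h : ∀ i x, incl 𝕜 E i x ∈ p) :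
    p = ⊤ := by
  have : p.mkQ = 0 := linearMap_ext fun i x => by simpa using h i x
  rw [← p.ker_mkQ, this, LinearMap.ker_zero]

/-- The elements of the direct sum whose coordinates outside of `S` vanish. -/
noncomputable def supported (𝕜 : Type*) [RCLike 𝕜] {ι : Type*} (E : ι → Type*) [∀ i, AddCommGroup (E i)]
    [∀ i, Module 𝕜 (E i)] (S : Set ι) : Submodule 𝕜 (LCDirectSum 𝕜 E) :=
  ⨅ i ∉ S, LinearMap.ker (coord 𝕜 E i)

theorem mem_supported {S : Set ι} {x : LCDirectSum 𝕜 E} :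
    x ∈ supported 𝕜 E S ↔ ∀ i ∉ S, coord 𝕜 E i x = 0 := by
  simp [supported]

theorem incl_mem_supported {S : Set ι} {i : ι} (hi : i ∈ S) (x : E i) :
    incl 𝕜 E i x ∈ supported 𝕜 E S :=
  mem_supported.2 fun _ hj => coord_incl_of_ne (fun h => hj (Eq.subst (motive := (· ∈ S)) h hi)) x

theorem supported_mono {S S' : Set ι} (h : S ⊆ S') : supported 𝕜 E S ≤ supported 𝕜 E S' :=
  fun _ hx => mem_supported.2 fun i hi => mem_supported.1 hx i fun hS => hi (h hS)

open Classical in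
/-- The restriction of families to a subset of the index set, as a linear map. -/
noncomputable def restrictₗ (𝕜 : Type*) [RCLike 𝕜] {ι : Type*} (E : ι → Type*)
    [∀ i, AddCommGroup (E i)] [∀ i, Module 𝕜 (E i)] (S : Set ι) :
    LCDirectSum 𝕜 E →ₗ[𝕜] LCDirectSum 𝕜 (fun i : S => E i) :=
  lift fun i => if h : i ∈ S then incl 𝕜 (fun i : S => E i) ⟨i, h⟩ else 0

/-- The extension of families by zero, as a linear map. -/
noncomputable def extendₗ (𝕜 : Type*) [RCLike 𝕜] {ι : Type*} (E : ι → Type*)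
    [∀ i, AddCommGroup (E i)] [∀ i, Module 𝕜 (E i)] (S : Set ι) :
    LCDirectSum 𝕜 (fun i : S => E i) →ₗ[𝕜] LCDirectSum 𝕜 E :=
  lift fun i => incl 𝕜 E i

theorem coord_restrictₗ (S : Set ι) (i : S) (x : LCDirectSum 𝕜 E) :
    coord 𝕜 (fun i : S => E i) i (restrictₗ 𝕜 E S x) = coord 𝕜 E i x := by
  refine LinearMap.congr_fun (f := coord 𝕜 (fun i : S => E i) i ∘ₗ restrictₗ 𝕜 E S)
    (g := coord 𝕜 E i) (linearMap_ext fun j y => ?_) x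
  simp only [LinearMap.comp_apply, restrictₗ, lift_incl]
  split_ifs with h
  · by_cases hij : j = i
    · subst hij
      exact (coord_incl_self (E := fun i : S => E i) i y).trans (coord_incl_self _ y).symm
    · rw [coord_incl_of_ne hij]
      exact coord_incl_of_ne (E := fun i : S => E i) (i := i) (j := ⟨j, h⟩)
        (fun h' => hij (congrArg Subtype.val h')) y
  · rw [coord_incl_of_ne (fun h' => h (Eq.subst (motive := (· ∈ S)) (Eq.symm h') i.2))]
    simp

theorem extendₗ_mem_supported (S : Set ι) (x : LCDirectSum 𝕜 (fun i : S => E i)) :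
    extendₗ 𝕜 E S x ∈ supported 𝕜 E S := by
  have : (supported 𝕜 E S).comap (extendₗ 𝕜 E S) = ⊤ := eq_top_of_incl_mem _ fun i y => by
    simpa [extendₗ] using incl_mem_supported i.2 y
  exact this.ge (Submodule.mem_top (x := x))

@[simp]
theorem restrictₗ_extendₗ (S : Set ι) (x : LCDirectSum 𝕜 (fun i : S => E i)) :
    restrictₗ 𝕜 E S (extendₗ 𝕜 E S x) = x := by
  refine LinearMap.congr_fun (f := restrictₗ 𝕜 E S ∘ₗ extendₗ 𝕜 E S)
    (g := LinearMap.id) (linearMap_ext fun j y => ?_) x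
  simp [restrictₗ, extendₗ]

theorem coord_extendₗ_restrictₗ (S : Set ι) {i : ι} (hi : i ∈ S) (x : LCDirectSum 𝕜 E) :
    coord 𝕜 E i (extendₗ 𝕜 E S (restrictₗ 𝕜 E S x)) = coord 𝕜 E i x := by
  rw [← coord_restrictₗ S ⟨i, hi⟩, restrictₗ_extendₗ, coord_restrictₗ]

theorem extendₗ_restrictₗ_of_mem {S : Set ι} {x : LCDirectSum 𝕜 E} (hx : x ∈ supported 𝕜 E S) :
    extendₗ 𝕜 E S (restrictₗ 𝕜 E S x) = x := by
  refine ext_coord fun i => ?_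
  by_cases hi : i ∈ S
  · exact coord_extendₗ_restrictₗ S hi x
  · rw [mem_supported.1 hx i hi, mem_supported.1 (extendₗ_mem_supported S _) i hi]

theorem restrictₗ_eq_zero {S S' : Set ι} (h : Disjoint S S') {x : LCDirectSum 𝕜 E}
    (hx : x ∈ supported 𝕜 E S') : restrictₗ 𝕜 E S x = 0 :=
  ext_coord fun i => by
    rw [coord_restrictₗ, mem_supported.1 hx i (Set.disjoint_left.1 h i.2), map_zero]

theorem sub_extendₗ_restrictₗ_mem {S S' : Set ι} {x : LCDirectSum 𝕜 E}
    (hx : x ∈ supported 𝕜 E (S ∪ S')) :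
    x - extendₗ 𝕜 E S (restrictₗ 𝕜 E S x) ∈ supported 𝕜 E S' := by
  refine mem_supported.2 fun i hi => ?_
  rw [map_sub]
  by_cases hS : i ∈ S
  · rw [coord_extendₗ_restrictₗ S hS, sub_self]
  · rw [mem_supported.1 hx i (by simp [hS, hi]),
      mem_supported.1 (extendₗ_mem_supported S _) i hS, sub_self]

theorem map_mem_of_mem_supported {F : Type*} [AddCommGroup F] [Module 𝕜 F]
    {f : LCDirectSum 𝕜 E →ₗ[𝕜] F} {p : Submodule 𝕜 F} {S : Set ι}
    (h : ∀ i ∈ S, ∀ x, f (incl 𝕜 E i x) ∈ p) {x : LCDirectSum 𝕜 E} (hx : x ∈ supported 𝕜 E S) :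
    f x ∈ p := by
  have : p.comap (f ∘ₗ extendₗ 𝕜 E S) = ⊤ := eq_top_of_incl_mem _ fun i y => by
    simpa [extendₗ] using h i i.2 y
  have hx' := this.ge (Submodule.mem_top (x := restrictₗ 𝕜 E S x))
  rwa [Submodule.mem_comap, LinearMap.comp_apply, extendₗ_restrictₗ_of_mem hx] at hx'

variable [∀ i, TopologicalSpace (E i)]

instance instIsTopologicalAddGroup : IsTopologicalAddGroup (LCDirectSum 𝕜 E) :=
  (withSeminorms 𝕜 E).topologicalAddGroup

/-- The restriction of families to a subset of the index set. -/
noncomputable def restrict (𝕜 : Type*) [RCLike 𝕜] {ι : Type*} (E : ι → Type*)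
    [∀ i, AddCommGroup (E i)] [∀ i, Module 𝕜 (E i)] [∀ i, TopologicalSpace (E i)]
    [∀ i, IsTopologicalAddGroup (E i)] (S : Set ι) :
    LCDirectSum 𝕜 E →L[𝕜] LCDirectSum 𝕜 (fun i : S => E i) where
  toLinearMap := restrictₗ 𝕜 E S
  cont := continuous_of_incl 𝕜 E (withSeminorms 𝕜 _) _ fun i => by
    by_cases h : i ∈ S
    · simpa [restrictₗ, h] using continuous_incl 𝕜 (fun i : S => E i) ⟨i, h⟩
    · simpa [restrictₗ, h] using continuous_const

/-- The extension of families by zero. -/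
noncomputable def extend (𝕜 : Type*) [RCLike 𝕜] {ι : Type*} (E : ι → Type*)
    [∀ i, AddCommGroup (E i)] [∀ i, Module 𝕜 (E i)] [∀ i, TopologicalSpace (E i)]
    [∀ i, IsTopologicalAddGroup (E i)] (S : Set ι) :
    LCDirectSum 𝕜 (fun i : S => E i) →L[𝕜] LCDirectSum 𝕜 E where
  toLinearMap := extendₗ 𝕜 E S
  cont := continuous_of_incl 𝕜 _ (withSeminorms 𝕜 E) _ fun i => by
    simpa [extendₗ] using continuous_incl 𝕜 E i

end Basic

/-! ### Maps from normed spaces have finite support. -/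

section FiniteSupport

variable {𝕜 : Type*} [RCLike 𝕜] {ι : Type*} {E : ι → Type*} [∀ i, NormedAddCommGroup (E i)]
  [∀ i, NormedSpace 𝕜 (E i)]

theorem summable_mul_norm_coord (c : ι → ℝ) (x : LCDirectSum 𝕜 E) :
    Summable fun i => c i * ‖coord 𝕜 E i x‖ :=
  summable_of_hasFiniteSupport <| (finite_coord_ne_zero x).subset fun i hi h => hi (by simp [h])

/-- The weighted sum of the norms of the coordinates. -/
noncomputable def weightedSeminorm (𝕜 : Type*) [RCLike 𝕜] {ι : Type*} (E : ι → Type*)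
    [∀ i, NormedAddCommGroup (E i)] [∀ i, NormedSpace 𝕜 (E i)] (c : ι → ℝ) (hc : ∀ i, 0 ≤ c i) :
    Seminorm 𝕜 (LCDirectSum 𝕜 E) :=
  Seminorm.of (fun x => ∑' i, c i * ‖coord 𝕜 E i x‖)
    (fun x y => by
      rw [← (summable_mul_norm_coord c x).tsum_add (summable_mul_norm_coord c y)]
      refine (summable_mul_norm_coord c (x + y)).tsum_le_tsum (fun i => ?_)
        ((summable_mul_norm_coord c x).add (summable_mul_norm_coord c y))
      rw [← mul_add, map_add]
      exact mul_le_mul_of_nonneg_left (norm_add_le _ _) (hc i))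
    (fun a x => by
      rw [← tsum_mul_left]
      refine tsum_congr fun i => ?_
      rw [map_smul, norm_smul]
      ring)

theorem continuous_weightedSeminorm (c : ι → ℝ) (hc : ∀ i, 0 ≤ c i) :
    Continuous (weightedSeminorm 𝕜 E c hc) := by
  refine (withSeminorms 𝕜 E).continuous_seminorm ⟨weightedSeminorm 𝕜 E c hc, fun i => ?_⟩
  have : ∀ x : E i, weightedSeminorm 𝕜 E c hc (incl 𝕜 E i x) = c i * ‖x‖ := fun x => by
    refine (tsum_eq_single i fun j hj => ?_).trans (by rw [coord_incl_self])
    rw [coord_incl_of_ne hj.symm, norm_zero, mul_zero]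
  simp_rw [this]
  fun_prop

theorem le_weightedSeminorm (c : ι → ℝ) (hc : ∀ i, 0 ≤ c i) (i : ι) (x : LCDirectSum 𝕜 E) :
    c i * ‖coord 𝕜 E i x‖ ≤ weightedSeminorm 𝕜 E c hc x :=
  (summable_mul_norm_coord c x).le_tsum i fun j _ => mul_nonneg (hc j) (norm_nonneg _)

/-- The range of a continuous linear map from a normed space to a direct sum of normed spaces is
contained in a finite partial sum. -/
theorem finite_coord_ne_zero_of_continuous {Z : Type*} [NormedAddCommGroup Z] [NormedSpace 𝕜 Z]
    (f : Z →ₗ[𝕜] LCDirectSum 𝕜 E) (hf : Continuous f) :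
    {i | ∃ z, coord 𝕜 E i (f z) ≠ 0}.Finite := by
  classical
  by_contra hinf
  have := Set.infinite_coe_iff.2 hinf
  let e := Infinite.natEmbedding {i | ∃ z, coord 𝕜 E i (f z) ≠ 0}
  choose z hz using fun n => (e n).2
  -- The weights make the `e n` coordinate of `f (z n)` contribute exactly `n * ‖z n‖`, which no
  -- bound `C * ‖z n‖` survives once `n > C`. They may grow arbitrarily, since continuity is only
  -- tested on single summands.
  let c : ι → ℝ := fun i =>
    if h : ∃ n, (e n : ι) = i then
      (h.choose : ℝ) * ‖z h.choose‖ / ‖coord 𝕜 E i (f (z h.choose))‖ else 0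
  have hc : ∀ i, 0 ≤ c i := fun i => by
    simp only [c]
    split_ifs <;> positivity
  have hce : ∀ n : ℕ, c (e n) * ‖coord 𝕜 E (e n) (f (z n))‖ = n * ‖z n‖ := fun n => by
    have h : ∃ m, (e m : ι) = e n := ⟨n, rfl⟩
    have hn : h.choose = n := e.injective (Subtype.ext h.choose_spec)
    simp only [c, dif_pos h, hn]
    exact div_mul_cancel₀ _ (norm_ne_zero_iff.2 (hz n))
  obtain ⟨C, hC, hbound⟩ := Seminorm.bound_of_continuous_normedSpace
    ((weightedSeminorm 𝕜 E c hc).comp f) ((continuous_weightedSeminorm c hc).comp hf)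
  obtain ⟨n, hn⟩ := exists_nat_gt C
  have hzn : 0 < ‖z n‖ := norm_pos_iff.2 fun h => hz n (by simp [h])
  have h1 := (le_weightedSeminorm c hc (e n) (f (z n))).trans (hbound (z n))
  rw [hce] at h1
  exact absurd (le_of_mul_le_mul_right h1 hzn) (not_le.2 hn)

end FiniteSupport

/-! ### Diagonal blocks and the comparison map. -/

section Blocks

variable {𝕜 : Type*} [RCLike 𝕜] {ι : Type*} {E : ι → Type*} [∀ i, AddCommGroup (E i)]
  [∀ i, Module 𝕜 (E i)] [∀ i, TopologicalSpace (E i)] [∀ i, IsTopologicalAddGroup (E i)]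
  {J : Type*} {ρ : ι → J} {P : LCDirectSum 𝕜 E →L[𝕜] LCDirectSum 𝕜 E}

/-- The diagonal block of `P` on a set of indices. -/
noncomputable def block (P : LCDirectSum 𝕜 E →L[𝕜] LCDirectSum 𝕜 E) (S : Set ι) :
    LCDirectSum 𝕜 (fun i : S => E i) →L[𝕜] LCDirectSum 𝕜 (fun i : S => E i) :=
  restrict 𝕜 E S ∘L P ∘L extend 𝕜 E S

theorem block_apply (S : Set ι) (x : LCDirectSum 𝕜 (fun i : S => E i)) :
    block P S x = restrictₗ 𝕜 E S (P (extendₗ 𝕜 E S x)) := rfl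

/-- The direct sum of the ranges of the diagonal blocks of `P` on the fibers of `ρ`. -/
abbrev BlockSum (P : LCDirectSum 𝕜 E →L[𝕜] LCDirectSum 𝕜 E) (ρ : ι → J) : Type _ :=
  LCDirectSum 𝕜 fun j => LinearMap.range (block P {k | ρ k = j}).toLinearMap

/-- The map from the sum of the ranges of the diagonal blocks that is `P` on each of them. -/
noncomputable def fromBlocks (P : LCDirectSum 𝕜 E →L[𝕜] LCDirectSum 𝕜 E) (ρ : ι → J) :
    BlockSum P ρ →L[𝕜] LCDirectSum 𝕜 E where
  toLinearMap := lift fun j => P.toLinearMap ∘ₗ extendₗ 𝕜 E {k | ρ k = j} ∘ₗ Submodule.subtype _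
  cont := continuous_of_incl 𝕜 _ (withSeminorms 𝕜 E) _ fun j => by
    simp only [lift_incl]
    exact (P ∘L extend 𝕜 E {k | ρ k = j}).continuous.comp continuous_subtype_val

theorem fromBlocks_incl (j : J) (y : LinearMap.range (block P {k | ρ k = j}).toLinearMap) :
    fromBlocks P ρ (incl 𝕜 _ j y) = P (extendₗ 𝕜 E {k | ρ k = j} y) :=
  lift_incl (E := fun j => LinearMap.range (block P {k | ρ k = j}).toLinearMap) _ j y

theorem map_fromBlocks (hP : ∀ x, P (P x) = P x) (y : BlockSum P ρ) :
    P (fromBlocks P ρ y) = fromBlocks P ρ y := by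
  refine LinearMap.congr_fun (f := P.toLinearMap ∘ₗ (fromBlocks P ρ).toLinearMap)
    (g := (fromBlocks P ρ).toLinearMap) (linearMap_ext fun j z => ?_) y
  change P (fromBlocks P ρ _) = fromBlocks P ρ _
  rw [fromBlocks_incl, hP]

end Blocks

/-! ### Block triangular idempotents. -/

section Triangular

variable {𝕜 : Type*} [RCLike 𝕜] {ι : Type*} {E : ι → Type*} [∀ i, AddCommGroup (E i)]
  [∀ i, Module 𝕜 (E i)] {J : Type*} [LinearOrder J] {ρ : ι → J}

theorem restrictₗ_fiber_eq_zero {j : J} {x : LCDirectSum 𝕜 E}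
    (hx : x ∈ supported 𝕜 E {k | ρ k < j}) : restrictₗ 𝕜 E {k | ρ k = j} x = 0 :=
  restrictₗ_eq_zero (Set.disjoint_left.2 fun _ h h' => h'.ne h) hx

theorem sub_mem_supported_lt {j : J} {x : LCDirectSum 𝕜 E}
    (hx : x ∈ supported 𝕜 E {k | ρ k ≤ j}) :
    x - extendₗ 𝕜 E {k | ρ k = j} (restrictₗ 𝕜 E {k | ρ k = j} x) ∈
      supported 𝕜 E {k | ρ k < j} :=
  sub_extendₗ_restrictₗ_mem (supported_mono (fun _ hk => hk.eq_or_lt) hx)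

variable [∀ i, TopologicalSpace (E i)]
  {P : LCDirectSum 𝕜 E →L[𝕜] LCDirectSum 𝕜 E}

theorem map_mem_supported_le
    (hρ : ∀ i x, P (incl 𝕜 E i x) ∈ supported 𝕜 E {k | ρ k ≤ ρ i}) (j : J)
    {x : LCDirectSum 𝕜 E} (hx : x ∈ supported 𝕜 E {k | ρ k ≤ j}) :
    P x ∈ supported 𝕜 E {k | ρ k ≤ j} := by
  change P.toLinearMap x ∈ _
  refine map_mem_of_mem_supported (fun i hi x => ?_) hx
  exact supported_mono (fun k (hk : ρ k ≤ ρ i) => le_trans hk hi) (hρ i x)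

theorem map_mem_supported_lt
    (hρ : ∀ i x, P (incl 𝕜 E i x) ∈ supported 𝕜 E {k | ρ k ≤ ρ i}) (j : J)
    {x : LCDirectSum 𝕜 E} (hx : x ∈ supported 𝕜 E {k | ρ k < j}) :
    P x ∈ supported 𝕜 E {k | ρ k < j} := by
  change P.toLinearMap x ∈ _
  refine map_mem_of_mem_supported (fun i hi x => ?_) hx
  exact supported_mono (fun k (hk : ρ k ≤ ρ i) => lt_of_le_of_lt hk hi) (hρ i x)

theorem map_extendₗ_mem (hρ : ∀ i x, P (incl 𝕜 E i x) ∈ supported 𝕜 E {k | ρ k ≤ ρ i}) (j : J)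
    (x : LCDirectSum 𝕜 (fun i : {k | ρ k = j} => E i)) :
    P (extendₗ 𝕜 E {k | ρ k = j} x) ∈ supported 𝕜 E {k | ρ k ≤ j} :=
  map_mem_supported_le hρ j (supported_mono (fun _ hk => le_of_eq hk) (extendₗ_mem_supported _ x))

variable [∀ i, IsTopologicalAddGroup (E i)]

/-- The restriction to a fiber is compatible with a triangular map, up to smaller fibers. -/
theorem block_restrictₗ (hρ : ∀ i x, P (incl 𝕜 E i x) ∈ supported 𝕜 E {k | ρ k ≤ ρ i}) (j : J)
    {x : LCDirectSum 𝕜 E} (hx : x ∈ supported 𝕜 E {k | ρ k ≤ j}) :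
    block P {k | ρ k = j} (restrictₗ 𝕜 E {k | ρ k = j} x) =
      restrictₗ 𝕜 E {k | ρ k = j} (P x) := by
  have h := restrictₗ_fiber_eq_zero (map_mem_supported_lt hρ j (sub_mem_supported_lt hx))
  rw [map_sub, map_sub, sub_eq_zero] at h
  rw [block_apply, h]


/-- Compression to a diagonal block is multiplicative for triangular maps: what is cut off lies in
strictly smaller fibers, and `P` keeps it there. -/
theorem block_idem (hρ : ∀ i x, P (incl 𝕜 E i x) ∈ supported 𝕜 E {k | ρ k ≤ ρ i})
    (hP : ∀ x, P (P x) = P x) (j : J) (x : LCDirectSum 𝕜 (fun i : {k | ρ k = j} => E i)) :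
    block P {k | ρ k = j} (block P {k | ρ k = j} x) = block P {k | ρ k = j} x := by
  conv_lhs => rw [block_apply _ x, block_restrictₗ hρ j (map_extendₗ_mem hρ j x), hP]
  rw [block_apply]

theorem block_of_mem_range (hρ : ∀ i x, P (incl 𝕜 E i x) ∈ supported 𝕜 E {k | ρ k ≤ ρ i})
    (hP : ∀ x, P (P x) = P x) (j : J)
    (x : LinearMap.range (block P {k | ρ k = j}).toLinearMap) :
    block P {k | ρ k = j} x = x := by
  obtain ⟨_, y, rfl⟩ := x
  exact block_idem hρ hP j y

theorem closedComplemented_range_block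
    (hρ : ∀ i x, P (incl 𝕜 E i x) ∈ supported 𝕜 E {k | ρ k ≤ ρ i})
    (hP : ∀ x, P (P x) = P x) (j : J) :
    (LinearMap.range (block P {k | ρ k = j}).toLinearMap).ClosedComplemented :=
  ⟨(block P {k | ρ k = j}).codRestrict _ fun x => LinearMap.mem_range_self _ x,
    fun x => Subtype.ext (block_of_mem_range hρ hP j x)⟩

/-- The highest block component of `y` can be read off from its image. -/
theorem restrictₗ_fromBlocks (hρ : ∀ i x, P (incl 𝕜 E i x) ∈ supported 𝕜 E {k | ρ k ≤ ρ i})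
    (hP : ∀ x, P (P x) = P x) (j : J) {y : BlockSum P ρ}
    (hy : y ∈ supported 𝕜 _ {k | k ≤ j}) :
    restrictₗ 𝕜 E {k | ρ k = j} (fromBlocks P ρ y) = coord 𝕜 _ j y := by
  let f : BlockSum P ρ →ₗ[𝕜] LCDirectSum 𝕜 (fun i : {k | ρ k = j} => E i) :=
    restrictₗ 𝕜 E {k | ρ k = j} ∘ₗ (fromBlocks P ρ).toLinearMap -
      Submodule.subtype _ ∘ₗ coord 𝕜 _ j
  have hf : f y ∈ (⊥ : Submodule 𝕜 _) := by
    refine map_mem_of_mem_supported (fun i hi z => ?_) hy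
    rw [Submodule.mem_bot]
    change restrictₗ 𝕜 E {k | ρ k = j} (fromBlocks P ρ (incl 𝕜 _ i z)) -
      (coord 𝕜 (fun j => LinearMap.range (block P {k | ρ k = j}).toLinearMap) j
        (incl 𝕜 _ i z)).1 = 0
    rw [fromBlocks_incl, sub_eq_zero]
    rcases eq_or_lt_of_le (show i ≤ j from hi) with rfl | hij
    · rw [coord_incl_self, ← block_apply, block_of_mem_range hρ hP]
    · rw [coord_incl_of_ne hij.ne, Submodule.coe_zero]
      exact restrictₗ_fiber_eq_zero
        (supported_mono (fun k (hk : ρ k ≤ i) => hk.trans_lt hij) (map_extendₗ_mem hρ i _))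
  exact sub_eq_zero.1 ((Submodule.mem_bot 𝕜).1 hf)

/-- A nonzero `y` has a largest index with nonzero coordinate, and `restrictₗ_fromBlocks` recovers
that coordinate from the image. -/
theorem fromBlocks_injective (hρ : ∀ i x, P (incl 𝕜 E i x) ∈ supported 𝕜 E {k | ρ k ≤ ρ i})
    (hP : ∀ x, P (P x) = P x) : Function.Injective (fromBlocks P ρ) := by
  refine (injective_iff_map_eq_zero (fromBlocks P ρ)).2 fun y hy => ?_
  by_contra hne
  have hs := finite_coord_ne_zero y
  have hs0 : {j | coord 𝕜 _ j y ≠ 0}.Nonempty := by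
    by_contra h
    refine hne (ext_coord fun j => ?_)
    rw [map_zero]
    exact not_not.1 fun hj => h ⟨j, hj⟩
  obtain ⟨j, hj, hmax⟩ := Set.exists_max_image _ id hs hs0
  have h := restrictₗ_fromBlocks hρ hP j (y := y)
    (mem_supported.2 fun k hk => not_not.1 fun h => hk (hmax k h))
  rw [hy, map_zero] at h
  exact hj (Subtype.ext h.symm)

/-- The recursion step for inverting `fromBlocks`: an element in the range of a triangular
idempotent is the sum of an element of a block and of the image of an element supported on
smaller fibers. -/
theorem eq_fromBlocks_add (hρ : ∀ i x, P (incl 𝕜 E i x) ∈ supported 𝕜 E {k | ρ k ≤ ρ i})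
    (j : J) {x : LCDirectSum 𝕜 E} (hx : P x = x)
    (hxj : x ∈ supported 𝕜 E {k | ρ k ≤ j}) :
    ∃ h : restrictₗ 𝕜 E {k | ρ k = j} x ∈ LinearMap.range (block P {k | ρ k = j}).toLinearMap,
      x = fromBlocks P ρ (incl 𝕜 _ j ⟨_, h⟩) +
        P (x - extendₗ 𝕜 E {k | ρ k = j} (restrictₗ 𝕜 E {k | ρ k = j} x)) := by
  refine ⟨⟨restrictₗ 𝕜 E {k | ρ k = j} x, ?_⟩, ?_⟩
  · exact (block_restrictₗ hρ j hxj).trans (by rw [hx])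
  · rw [fromBlocks_incl, map_sub, add_sub_cancel, hx]

variable [WellFoundedLT J]

/-- Split off the leading block of `P (incl 𝕜 E i x)`; the remainder is `P` of an element supported
on smaller fibers, covered by induction on `ρ i`. -/
theorem exists_fromBlocks_eq (hρ : ∀ i x, P (incl 𝕜 E i x) ∈ supported 𝕜 E {k | ρ k ≤ ρ i})
    (hP : ∀ x, P (P x) = P x) (x : LCDirectSum 𝕜 E) : ∃ y, fromBlocks P ρ y = P x := by
  have key : ∀ j : J, ∀ i, ρ i = j → ∀ x, P (incl 𝕜 E i x) ∈
      LinearMap.range (fromBlocks P ρ).toLinearMap := by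
    intro j
    induction j using WellFoundedLT.induction with
    | ind j ih =>
      rintro i rfl x
      obtain ⟨h, hx⟩ := eq_fromBlocks_add hρ (ρ i) (hP (incl 𝕜 E i x)) (hρ i x)
      rw [hx]
      refine add_mem (LinearMap.mem_range_self _ _) ?_
      change P.toLinearMap _ ∈ _
      exact map_mem_of_mem_supported (fun k hk z => ih (ρ k) hk k rfl z)
        (sub_mem_supported_lt (hρ i x))
  have h := eq_top_of_incl_mem ((LinearMap.range (fromBlocks P ρ).toLinearMap).comap
    P.toLinearMap) fun i x => key (ρ i) i rfl x
  exact h.ge (Submodule.mem_top (x := x))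

/-- An inverse of `fromBlocks` on the range of a triangular idempotent is continuous. -/
theorem continuous_of_fromBlocks_eq
    (hρ : ∀ i x, P (incl 𝕜 E i x) ∈ supported 𝕜 E {k | ρ k ≤ ρ i})
    (hP : ∀ x, P (P x) = P x) (g : LCDirectSum 𝕜 E →ₗ[𝕜] BlockSum P ρ)
    (hg : ∀ x, fromBlocks P ρ (g x) = P x) : Continuous g := by
  refine continuous_of_incl 𝕜 E (withSeminorms 𝕜 _) g fun i => ?_
  generalize hj : ρ i = j
  induction j using WellFoundedLT.induction generalizing i with
  | ind j ih =>
    subst hj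
    let R := restrictₗ 𝕜 E {k | ρ k = ρ i}
    let w : E i → LCDirectSum 𝕜 E := fun x =>
      P (incl 𝕜 E i x) - extendₗ 𝕜 E {k | ρ k = ρ i} (R (P (incl 𝕜 E i x)))
    have hmem : ∀ x, R (P (incl 𝕜 E i x)) ∈
        LinearMap.range (block P {k | ρ k = ρ i}).toLinearMap := fun x =>
      (eq_fromBlocks_add hρ (ρ i) (hP (incl 𝕜 E i x)) (hρ i x)).1
    -- Inserting restriction and extension leaves `w x` unchanged, but lets `g` act only through the
    -- smaller fibers, where the induction hypothesis gives continuity.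
    have hrec : ∀ x, g (incl 𝕜 E i x) = incl 𝕜 _ (ρ i) ⟨_, hmem x⟩ +
        g (extendₗ 𝕜 E {k | ρ k < ρ i} (restrictₗ 𝕜 E {k | ρ k < ρ i} (w x))) := fun x => by
      refine fromBlocks_injective hρ hP ?_
      rw [map_add, hg, hg, extendₗ_restrictₗ_of_mem (sub_mem_supported_lt (hρ i x))]
      exact (eq_fromBlocks_add hρ (ρ i) (hP (incl 𝕜 E i x)) (hρ i x)).2
    have hPi : Continuous fun x => P (incl 𝕜 E i x) := P.continuous.comp (continuous_incl 𝕜 E i)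
    have hRi : Continuous fun x => R (P (incl 𝕜 E i x)) :=
      (restrict 𝕜 E {k | ρ k = ρ i}).continuous.comp hPi
    have hw : Continuous w := hPi.sub ((extend 𝕜 E {k | ρ k = ρ i}).continuous.comp hRi)
    have hlow : Continuous (g ∘ₗ extendₗ 𝕜 E {k | ρ k < ρ i}) :=
      continuous_of_incl 𝕜 _ (withSeminorms 𝕜 _) _ fun k => by
        simpa [extendₗ] using ih (ρ k) k.2 k rfl
    simp_rw [hrec]
    refine Continuous.add ?_ ?_
    · exact (continuous_incl 𝕜 _ (ρ i)).comp (hRi.subtype_mk hmem)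
    · exact hlow.comp ((restrict 𝕜 E {k | ρ k < ρ i}).continuous.comp hw)

/-- The range of a triangular idempotent is isomorphic to the direct sum of the ranges of its
diagonal blocks. -/
theorem nonempty_equiv_blockSum
    (hρ : ∀ i x, P (incl 𝕜 E i x) ∈ supported 𝕜 E {k | ρ k ≤ ρ i})
    {X : Submodule 𝕜 (LCDirectSum 𝕜 E)} (hPX : ∀ x, P x ∈ X) (hX : ∀ x ∈ X, P x = x) :
    Nonempty (X ≃L[𝕜] BlockSum P ρ) := by
  have hP : ∀ x, P (P x) = P x := fun x => hX _ (hPX x)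
  let Φ : BlockSum P ρ →L[𝕜] X := (fromBlocks P ρ).codRestrict X fun y => by
    rw [← map_fromBlocks hP]
    exact hPX _
  have hbij : Function.Bijective Φ := by
    refine ⟨fun y z h => fromBlocks_injective hρ hP (congrArg Subtype.val h), fun x => ?_⟩
    obtain ⟨y, hy⟩ := exists_fromBlocks_eq (ρ := ρ) hρ hP x
    exact ⟨y, Subtype.ext (hy.trans (hX x x.2))⟩
  let e := LinearEquiv.ofBijective Φ.toLinearMap hbij
  have he : ∀ x, fromBlocks P ρ (e.symm x) = x := fun x =>
    congrArg Subtype.val (e.apply_symm_apply x)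
  -- The inverse is precomposed with `P` to be defined on the whole direct sum, where the universal
  -- property applies; on `X` nothing changes.
  have hcont : Continuous (e.symm.toLinearMap ∘ₗ P.toLinearMap.codRestrict X hPX) :=
    continuous_of_fromBlocks_eq hρ hP _ fun x => he _
  refine ⟨{ e.symm with
    continuous_toFun := ?_
    continuous_invFun := Φ.continuous }⟩
  have h : ∀ x : X, e.symm x = (e.symm.toLinearMap ∘ₗ P.toLinearMap.codRestrict X hPX) x :=
    fun x => congrArg e.symm (Subtype.ext (hX x x.2).symm)
  change Continuous fun x : X => e.symm x
  simp_rw [h]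
  exact hcont.comp continuous_subtype_val

end Triangular

end LCDirectSum

/-! ### Partition of the index set into countable fibers. -/

theorem countable_setOf_reflTransGen {T : Type*} {R : T → T → Prop}
    (hR : ∀ t, {s | R t s}.Countable) (t : T) : {s | Relation.ReflTransGen R t s}.Countable := by
  -- `S n` collects the points reached from `t` in exactly `n` steps.
  let S : ℕ → Set T := fun n => Nat.rec {t} (fun _ S => ⋃ u ∈ S, {s | R u s}) n
  have hS : ∀ n, (S n).Countable := fun n => by
    induction n with
    | zero => exact Set.countable_singleton t
    | succ n ih => exact ih.biUnion fun u _ => hR u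
  refine (Set.countable_iUnion hS).mono fun s hs => ?_
  induction hs with
  | refl => exact Set.mem_iUnion.2 ⟨0, rfl⟩
  | tail _ h ih =>
    obtain ⟨n, hn⟩ := Set.mem_iUnion.1 ih
    exact Set.mem_iUnion.2 ⟨n + 1, Set.mem_biUnion hn h⟩

/-- For a countable-valued relation on an infinite set, there is a map to a well-ordered set with
countably infinite fibers along which the relation is decreasing. -/
theorem exists_countable_fibers {T : Type*} [Infinite T] (A : T → Set T)
    (hA : ∀ t, (A t).Countable) :
    ∃ (J : Set T) (_ : LinearOrder J) (_ : WellFoundedLT J) (ρ : T → J),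
      (∀ t, ∀ s ∈ A t, ρ s ≤ ρ t) ∧ ∀ j, Cardinal.mk {t | ρ t = j} = Cardinal.aleph0 := by
  -- This cuts `T` into countably infinite classes. Making classmates mutually related in `R` forces
  -- every fiber to be infinite.
  obtain ⟨e⟩ : Nonempty (T ≃ T × ℕ) := Cardinal.eq.1 (by simp)
  let R : T → T → Prop := fun t s => s ∈ A t ∨ (e s).1 = (e t).1
  have hR : ∀ t, {s | R t s}.Countable := fun t => by
    refine (hA t).union ((Set.countable_range fun n => e.symm ((e t).1, n)).mono ?_)
    exact fun s hs => ⟨(e s).2, by rw [← show (e s).1 = (e t).1 from hs]; simp⟩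
  have hC : ∀ s, {t | Relation.ReflTransGen R s t}.Countable :=
    countable_setOf_reflTransGen hR
  obtain ⟨_, _⟩ := exists_wellFoundedLT T
  have hne : ∀ t, {s | Relation.ReflTransGen R s t}.Nonempty := fun t => ⟨t, .refl⟩
  -- `m t` is the least point from which `t` can be reached. Along `R` the set of such points grows,
  -- so `m` decreases; and a fiber lies in the countable set of points reachable from its value.
  let m : T → T := fun t => WellFounded.min wellFounded_lt _ (hne t)
  have hm : ∀ t, Relation.ReflTransGen R (m t) t := fun t => WellFounded.min_mem _ _ (hne t)
  have hmono : ∀ t s, R t s → m s ≤ m t := fun t s h =>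
    WellFounded.min_le wellFounded_lt (s := {r | Relation.ReflTransGen R r s}) ((hm t).tail h)
  refine ⟨Set.range m, inferInstance, inferInstance, Set.rangeFactorization m,
    fun t s hs => hmono t s (.inl hs), ?_⟩
  rintro ⟨_, t, rfl⟩
  have hset : {s | Set.rangeFactorization m s = ⟨m t, t, rfl⟩} = {s | m s = m t} := by
    ext s
    simp [Set.rangeFactorization, Subtype.ext_iff]
  rw [hset]
  have hinf : {s | m s = m t}.Infinite := by
    refine (Set.infinite_range_of_injective (f := fun n : ℕ => e.symm ((e t).1, n))
      fun a b h => by simpa using h).mono ?_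
    rintro _ ⟨n, rfl⟩
    exact le_antisymm (hmono _ _ (.inr (by simp))) (hmono _ _ (.inr (by simp)))
  have hcount : {s | m s = m t}.Countable :=
    (hC (m t)).mono fun s hs => (show m s = m t from hs) ▸ hm s
  have := hinf.to_subtype
  have := hcount.to_subtype
  exact Cardinal.mk_eq_aleph0 _

theorem theoremT {𝕜 : Type w} [RCLike 𝕜] {T : Type u} [Uncountable T] (B : T → Type v)
    [∀ t, NormedAddCommGroup (B t)] [∀ t, NormedSpace 𝕜 (B t)] [∀ t, CompleteSpace (B t)]
    (X : Submodule 𝕜 (LCDirectSum 𝕜 B)) (hX : X.ClosedComplemented) :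
    ∃ (J : Type u) (S : J → Set T)
      (F : ∀ j, Submodule 𝕜 (LCDirectSum 𝕜 (fun t : S j => B t))),
      (∀ j, Cardinal.mk (S j) = Cardinal.aleph0) ∧
      (∀ j, (F j).ClosedComplemented) ∧
      Nonempty (X ≃L[𝕜] LCDirectSum 𝕜 (fun j => F j)) := by
  obtain ⟨r, hr⟩ := hX
  let P : LCDirectSum 𝕜 B →L[𝕜] LCDirectSum 𝕜 B := X.subtypeL ∘L r
  have hPX : ∀ x, P x ∈ X := fun x => (r x).2
  have hX : ∀ x ∈ X, P x = x := fun x hx => congrArg Subtype.val (hr ⟨x, hx⟩)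
  -- The relation sends `t` to the finitely many coordinates met by the image of `B t` under `P`.
  obtain ⟨J, _, _, ρ, hρ, hcard⟩ := exists_countable_fibers
    (fun t => {s | ∃ z, LCDirectSum.coord 𝕜 B s (P (LCDirectSum.incl 𝕜 B t z)) ≠ 0})
    fun t => (LCDirectSum.finite_coord_ne_zero_of_continuous
      (P.toLinearMap ∘ₗ LCDirectSum.incl 𝕜 B t)
      (P.continuous.comp (LCDirectSum.continuous_incl 𝕜 B t))).countable
  have hρP : ∀ t z, P (LCDirectSum.incl 𝕜 B t z) ∈
      LCDirectSum.supported 𝕜 B {s | ρ s ≤ ρ t} := fun t z =>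
    LCDirectSum.mem_supported.2 fun s hs => not_not.1 fun h => hs (hρ t s ⟨z, h⟩)
  exact ⟨J, fun j => {t | ρ t = j}, fun j => LinearMap.range (LCDirectSum.block P _).toLinearMap,
    hcard, LCDirectSum.closedComplemented_range_block hρP fun x => hX _ (hPX x),
    LCDirectSum.nonempty_equiv_blockSum hρP hPX hX⟩
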